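/- Let $(X,\mathcal F,\mu)$ be a probability space and let $T:X\to X$ be an ergodic measure preserving transformation. Let $d\ge 2$ be an integer, let $p\ge d$ be a real number, and put $r=p/d$. All $L_p$ spaces are taken over the scalar field $\mathbb K=\mathbb R$ or $\mathbb C$. Let $L_{p,\pi}(\mu^d)=L_p(\mu)\,\hat\otimes_\pi\cdots\hat\otimes_\pi L_p(\mu)$ be the projective tensor product of $d$ copies of $L_p(\mu)$, that is, the completion of the algebraic tensor product with respect to the projective norm. Define the following continuous linear operators by their values on elementary tensors: - $J_d:L_{p,\pi}(\mu^d)\to L_p(\mu^d)$, with $J_d(f_1\otimes\cdots\otimes f_d)(x_1,\dots,x_d)=f_1(x_1)\cdots f_d(x_d)$; - $D_d:L_{p,\pi}(\mu^d)\to L_r(\mu)$, with $D_d(f_1\otimes\cdots\otimes f_d)(x)=f_1(x)\cdots f_d(x)$; - for integers $k_1,\dots,k_d\ge 0$, $V^{(k_1,\dots,k_d)}:L_{p,\pi}(\mu^d)\to L_{p,\pi}(\mu^d)$, with $V^{(k_1,\dots,k_d)}(f_1\otimes\cdots\otimes f_d)=(f_1\circ T^{k_1})\otimes\cdots\otimes(f_d\circ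 T^{k_d})$. Then for every $f\in L_{p,\pi}(\mu^d)$ the sequence $$\frac1{n^d}\sum_{0\le k_1,\dots,k_d\le n-1}D_dV^{(k_1,\dots,k_d)}f$$ converges, as $n\to\infty$, $\mu$-almost surely and in the norm of $L_r(\mu)$ to the constant $$\int_{X^d}(J_df)(x_1,\dots,x_d)\,\mu(dx_1)\cdots\mu(dx_d).$$ -/

import Mathlib

open MeasureTheory Filter
open scoped ENNReal Topology TensorProduct

noncomputable section

namespace VonMises

/-! ### Products of `L_p` functions -/

section Product

variable {𝕜 X Y : Type*} [RCLike 𝕜] [MeasurableSpace X] [MeasurableSpace Y]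
  {μ : Measure X} {ν : Measure Y} {p q : ℝ≥0∞} {d : ℕ}

/-- The product function `y ↦ f₁(e₁ y) ⋯ f_d(e_d y)`. -/
def prodComp (e : Fin d → Y → X) (f : Fin d → Lp 𝕜 p μ) : Y → 𝕜 :=
  fun y => ∏ i, f i (e i y)

theorem aestronglyMeasurable_prodComp {e : Fin d → Y → X}
    (he : ∀ i, MeasurePreserving (e i) ν μ) (f : Fin d → Lp 𝕜 p μ) :
    AEStronglyMeasurable (prodComp e f) ν :=
  Finset.aestronglyMeasurable_fun_prod _ fun i _ =>
    (Lp.aestronglyMeasurable (f i)).comp_measurePreserving (he i)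

theorem memLp_prodComp {e : Fin d → Y → X} (he : ∀ i, MeasurePreserving (e i) ν μ)
    (hb : ∀ f : Fin d → Lp 𝕜 p μ, eLpNorm (prodComp e f) q ν ≤ ∏ i, eLpNorm (f i) p μ)
    (f : Fin d → Lp 𝕜 p μ) : MemLp (prodComp e f) q ν :=
  ⟨aestronglyMeasurable_prodComp he f, (hb f).trans_lt <|
    ENNReal.prod_lt_top fun i _ => Lp.eLpNorm_lt_top (f i)⟩

/-- The continuous `d`-linear map `(f₁, …, f_d) ↦ (y ↦ f₁(e₁ y) ⋯ f_d(e_d y))` from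
`L_p(μ) × ⋯ × L_p(μ)` to `L_q(ν)`, for measure preserving maps `e_i : Y → X` for which the
norm inequality `‖∏ f_i ∘ e_i‖_q ≤ ∏ ‖f_i‖_p` holds. -/
def prodCompMultilinear [Fact (1 ≤ p)] [Fact (1 ≤ q)] (e : Fin d → Y → X)
    (he : ∀ i, MeasurePreserving (e i) ν μ)
    (hb : ∀ f : Fin d → Lp 𝕜 p μ, eLpNorm (prodComp e f) q ν ≤ ∏ i, eLpNorm (f i) p μ) :
    ContinuousMultilinearMap 𝕜 (fun _ : Fin d => Lp 𝕜 p μ) (Lp 𝕜 q ν) :=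
  MultilinearMap.mkContinuous
    { toFun := fun f => (memLp_prodComp he hb f).toLp (prodComp e f)
      map_update_add' := by
        intro _ m i a b
        refine Lp.ext ?_
        filter_upwards [MemLp.coeFn_toLp (memLp_prodComp he hb (Function.update m i (a + b))),
          MemLp.coeFn_toLp (memLp_prodComp he hb (Function.update m i a)),
          MemLp.coeFn_toLp (memLp_prodComp he hb (Function.update m i b)),
          Lp.coeFn_add ((memLp_prodComp he hb (Function.update m i a)).toLp _)
            ((memLp_prodComp he hb (Function.update m i b)).toLp _),
          (he i).quasiMeasurePreserving.ae (Lp.coeFn_add a b)] with y h1 h2 h3 h4 h5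
        rw [h1, h4, Pi.add_apply, h2, h3]
        have key : ∀ c : Lp 𝕜 p μ, prodComp e (Function.update m i c) y
            = c (e i y) * ∏ j ∈ Finset.univ.erase i, m j (e j y) := by
          intro c
          unfold prodComp
          rw [← Finset.mul_prod_erase _ _ (Finset.mem_univ i), Function.update_self]
          congr 1
          refine Finset.prod_congr ?_ fun j hj => ?_
          · congr!
          · rw [Function.update_of_ne (Finset.ne_of_mem_erase hj)]
        rw [key, key, key, h5, Pi.add_apply, add_mul]
      map_update_smul' := by
        intro _ m i c a
        refine Lp.ext ?_
        filter_upwards [MemLp.coeFn_toLp (memLp_prodComp he hb (Function.update m i (c • a))),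
          MemLp.coeFn_toLp (memLp_prodComp he hb (Function.update m i a)),
          Lp.coeFn_smul c ((memLp_prodComp he hb (Function.update m i a)).toLp _),
          (he i).quasiMeasurePreserving.ae (Lp.coeFn_smul c a)] with y h1 h2 h4 h5
        rw [h1, h4, Pi.smul_apply, h2]
        have key : ∀ c : Lp 𝕜 p μ, prodComp e (Function.update m i c) y
            = c (e i y) * ∏ j ∈ Finset.univ.erase i, m j (e j y) := by
          intro c
          unfold prodComp
          rw [← Finset.mul_prod_erase _ _ (Finset.mem_univ i), Function.update_self]
          congr 1
          refine Finset.prod_congr ?_ fun j hj => ?_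
          · congr!
          · rw [Function.update_of_ne (Finset.ne_of_mem_erase hj)]
        rw [key, key, h5, Pi.smul_apply, smul_mul_assoc] }
    1 (by
      intro f
      rw [one_mul]
      change ‖(memLp_prodComp he hb f).toLp (prodComp e f)‖ ≤ _
      rw [Lp.norm_toLp]
      simp only [Lp.norm_def]
      rw [← ENNReal.toReal_prod]
      exact ENNReal.toReal_mono
        (ENNReal.prod_lt_top fun i _ => Lp.eLpNorm_lt_top (f i)).ne (hb f))

theorem enorm_finset_prod {ι : Type*} (s : Finset ι) (g : ι → 𝕜) :
    ‖∏ i ∈ s, g i‖ₑ = ∏ i ∈ s, ‖g i‖ₑ := by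
  simp only [enorm_eq_nnnorm, nnnorm_prod, ENNReal.ofNNReal_finsetProd]

/-- Hölder's inequality for the pointwise product of finitely many functions. -/
theorem eLpNorm_prod_le {ι : Type*} (s : Finset ι) (p : ℝ≥0∞) (f : ι → X → 𝕜)
    (hf : ∀ i, AEStronglyMeasurable (f i) μ) :
    eLpNorm (fun x => ∏ i ∈ s, f i x) (∑ _i ∈ s, p⁻¹)⁻¹ μ ≤ ∏ i ∈ s, eLpNorm (f i) p μ := by
  classical
  induction s using Finset.cons_induction with
  | empty =>
    simp only [Finset.prod_empty, Finset.sum_empty, ENNReal.inv_zero, eLpNorm_exponent_top]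
    exact eLpNormEssSup_le_of_ae_enorm_bound (by simp)
  | cons i s hi ih =>
    simp only [Finset.prod_cons]
    have : ENNReal.HolderTriple p (∑ _i ∈ s, p⁻¹)⁻¹ (∑ _i ∈ Finset.cons i s hi, p⁻¹)⁻¹ :=
      ⟨by rw [Finset.sum_cons, inv_inv, inv_inv]⟩
    refine (eLpNorm_smul_le_mul_eLpNorm (p := p) (q := (∑ _i ∈ s, p⁻¹)⁻¹)
      (Finset.aestronglyMeasurable_fun_prod s fun j _ => hf j) (hf i)).trans ?_
    gcongr

theorem eLpNorm_prodComp_diag_le {r : ℝ≥0∞} (hp : p ≠ 0) (hr : r = p / d)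
    (f : Fin d → Lp 𝕜 p μ) :
    eLpNorm (prodComp (fun _ => id) f) r μ ≤ ∏ i, eLpNorm (f i) p μ := by
  have h := eLpNorm_prod_le (μ := μ) Finset.univ p (fun i => ⇑(f i))
    fun i => Lp.aestronglyMeasurable (f i)
  have h2 : (∑ _i : Fin d, p⁻¹)⁻¹ = r := by
    rw [hr, Finset.sum_const, Finset.card_univ, Fintype.card_fin, nsmul_eq_mul,
      ENNReal.mul_inv (Or.inr (ENNReal.inv_ne_top.2 hp)) (Or.inl (ENNReal.natCast_ne_top d)),
      inv_inv, mul_comm, ← div_eq_mul_inv]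
  rw [h2] at h
  exact h

theorem eLpNorm_prodComp_eval_le [IsProbabilityMeasure μ] (hp : p ≠ 0) (f : Fin d → Lp 𝕜 p μ) :
    eLpNorm (prodComp (fun i (y : Fin d → X) => y i) f) p (Measure.pi fun _ => μ)
      ≤ ∏ i, eLpNorm (f i) p μ := by
  by_cases hp' : p = ∞
  · subst hp'
    simp only [eLpNorm_exponent_top]
    refine essSup_le_of_ae_le _ ?_
    have h : ∀ i : Fin d, ∀ᵐ y : Fin d → X ∂(Measure.pi fun _ => μ),
        ‖f i (y i)‖ₑ ≤ eLpNormEssSup (f i) μ := fun i =>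
      (measurePreserving_eval (fun _ : Fin d => μ) i).quasiMeasurePreserving.ae
        ae_le_eLpNormEssSup
    filter_upwards [ae_all_iff.2 h] with y hy
    unfold prodComp
    rw [enorm_finset_prod]
    exact Finset.prod_le_prod' fun i _ => hy i
  · simp only [eLpNorm_eq_lintegral_rpow_enorm_toReal hp hp']
    rw [ENNReal.prod_rpow_of_nonneg (by positivity)]
    gcongr
    have hm : ∀ i, Measurable fun x => ‖f i x‖ₑ ^ p.toReal := fun i =>
      ((Lp.stronglyMeasurable (f i)).enorm).pow_const _
    have hind := ProbabilityTheory.iIndepFun_pi (μ := fun _ : Fin d => μ)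
      (X := fun i x => ‖f i x‖ₑ ^ p.toReal) fun i => (hm i).aemeasurable
    have := ProbabilityTheory.lintegral_prod_eq_prod_lintegral_of_indepFun Finset.univ _ hind
      fun i => (hm i).comp (measurable_pi_apply i)
    refine le_of_eq (Eq.trans (lintegral_congr fun y => ?_) (this.trans ?_))
    · unfold prodComp
      rw [enorm_finset_prod, ENNReal.prod_rpow_of_nonneg ENNReal.toReal_nonneg]
    · exact Finset.prod_congr rfl fun i _ =>
        (measurePreserving_eval (fun _ : Fin d => μ) i).lintegral_comp (hm i)

end Product

/-! ### The projective tensor power `L_{p,π}(μ^d)` -/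

section Projective

variable (𝕜 : Type*) {X : Type*} [RCLike 𝕜] [MeasurableSpace X] (μ : Measure X)
  (p : ℝ≥0∞) [Fact (1 ≤ p)] (d : ℕ)

/-- The algebraic tensor power `L_p(μ) ⊗ ⋯ ⊗ L_p(μ)` (`d` factors); Mathlib equips it with the
projective norm. -/
abbrev AlgTensorPower : Type _ := ⨂[𝕜] _i : Fin d, Lp 𝕜 p μ

/-- `L_{p,π}(μ^d)`, the projective tensor product of `d` copies of `L_p(μ)`: the completion of the
algebraic tensor product with respect to the projective norm. -/
abbrev LpProj : Type _ := UniformSpace.Completion (AlgTensorPower 𝕜 μ p d)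

variable {𝕜 μ p d}

/-- The operator `J_d : L_{p,π}(μ^d) → L_p(μ^d)`, the continuous linear extension of
`f₁ ⊗ ⋯ ⊗ f_d ↦ ((x₁, …, x_d) ↦ f₁(x₁) ⋯ f_d(x_d))`. -/
def embJ [IsProbabilityMeasure μ] :
    LpProj 𝕜 μ p d →L[𝕜] Lp 𝕜 p (Measure.pi fun _ : Fin d => μ) :=
  (PiTensorProduct.liftIsometry 𝕜 (fun _ : Fin d => Lp 𝕜 p μ) _
    (prodCompMultilinear (fun i (y : Fin d → X) => y i)
      (fun i => measurePreserving_eval (fun _ : Fin d => μ) i)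
      (eLpNorm_prodComp_eval_le (zero_lt_one.trans_le Fact.out).ne'))).fromCompletion

/-- The restriction operator `D_d : L_{p,π}(μ^d) → L_r(μ)`, `r = p/d`, the continuous linear
extension of `f₁ ⊗ ⋯ ⊗ f_d ↦ (x ↦ f₁(x) ⋯ f_d(x))`. -/
def restrD {r : ℝ≥0∞} [Fact (1 ≤ r)] (hr : r = p / d) : LpProj 𝕜 μ p d →L[𝕜] Lp 𝕜 r μ :=
  (PiTensorProduct.liftIsometry 𝕜 (fun _ : Fin d => Lp 𝕜 p μ) _
    (prodCompMultilinear (fun _ => id) (fun _ => MeasurePreserving.id μ)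
      (eLpNorm_prodComp_diag_le (zero_lt_one.trans_le Fact.out).ne' hr))).fromCompletion

/-- The isometry `V f = f ∘ T` of `L_p(μ)`, as a continuous linear operator. -/
def koopman {T : X → X} (hT : MeasurePreserving T μ μ) : Lp 𝕜 p μ →L[𝕜] Lp 𝕜 p μ :=
  (Lp.compMeasurePreservingₗᵢ 𝕜 T hT).toContinuousLinearMap

/-- The operator `V^{(k₁, …, k_d)} = V^{k₁} ⊗_π ⋯ ⊗_π V^{k_d}` of `L_{p,π}(μ^d)`. -/
def koopmanProj {T : X → X} (hT : MeasurePreserving T μ μ) (k : Fin d → ℕ) :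
    LpProj 𝕜 μ p d →L[𝕜] LpProj 𝕜 μ p d :=
  (PiTensorProduct.mapL fun i => (koopman hT : Lp 𝕜 p μ →L[𝕜] Lp 𝕜 p μ) ^ k i).completion

/-- The normalized von Mises statistic
`n^{-d} ∑_{0 ≤ k₁, …, k_d ≤ n-1} D_d V^{(k₁, …, k_d)} f`, an element of `L_r(μ)`. -/
def vStat {T : X → X} (hT : MeasurePreserving T μ μ) {r : ℝ≥0∞} [Fact (1 ≤ r)]
    (hr : r = p / d) (f : LpProj 𝕜 μ p d) (n : ℕ) : Lp 𝕜 r μ :=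
  ((n : 𝕜) ^ d)⁻¹ •
    ∑ k ∈ Fintype.piFinset (fun _ : Fin d => Finset.range n), restrD hr (koopmanProj hT k f)

end Projective

end VonMises

end

/-! On an elementary tensor the statistic factors: expanding a product of sums shows that it equals
the pointwise product of the `d` ergodic averages of `f₁, …, f_d`. Birkhoff's theorem and the mean
ergodic theorem then settle elementary tensors, hence the algebraic tensor product, with limit `∏ ∫
f_i`. What remains is to pass to the completion.

For norm convergence, the statistics are contractions from the projective norm to `L_r`, uniformly
in `n` (`norm_vStatL_le`), so density suffices.

Almost sure convergence needs pointwise control. If every `‖f_i‖ ≤ 1`, then `∏ |A_n f_i| ≤ ∑ (A_n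
|f_i|)^d ≤ A_n (∑ |f_i|^d)` by Jensen, and `∑ |f_i|^d` has integral at most `d` because `d ≤ p`.
Scaling, the definition of the projective norm as an infimum over representations, and a rapidly
converging series give every `g` in the completion a single `h` with `|vStat g| ≤ A_n h` and `∫ h`
bounded by a constant times `‖g‖` (`isDominated_of_norm_lt`). Birkhoff's theorem for `h` bounds the
limsup of the statistics of `g` by `∫ h`. This takes the place of a maximal inequality when `f` is
approximated by algebraic tensors. -/

noncomputable section

namespace VonMises

/-! ### The pointwise ergodic theorem -/

section Birkhoff

variable {X : Type*} {T : X → X} {f : X → ℝ}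

/-- The maximum of the Birkhoff sums of `f` over the times `0, …, N`. -/
def maxBirkhoffSum (T : X → X) (f : X → ℝ) : ℕ → X → ℝ
  | 0, _ => 0
  | N + 1, x => max 0 (f x + maxBirkhoffSum T f N (T x))

theorem maxBirkhoffSum_nonneg (N : ℕ) (x : X) : 0 ≤ maxBirkhoffSum T f N x := by
  cases N <;> simp [maxBirkhoffSum]

theorem maxBirkhoffSum_le_succ (N : ℕ) (x : X) :
    maxBirkhoffSum T f N x ≤ maxBirkhoffSum T f (N + 1) x := by
  induction N generalizing x with
  | zero => exact maxBirkhoffSum_nonneg _ _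
  | succ N ih =>
    rw [maxBirkhoffSum, maxBirkhoffSum]
    gcongr
    exact ih _

theorem birkhoffSum_le_maxBirkhoffSum (N : ℕ) (x : X) :
    birkhoffSum T f N x ≤ maxBirkhoffSum T f N x := by
  induction N generalizing x with
  | zero => simp [maxBirkhoffSum]
  | succ N ih =>
    rw [birkhoffSum_succ', maxBirkhoffSum]
    exact le_max_of_le_right (by gcongr; exact ih _)

/-- The set where the maxima stay bounded is exactly `T`-invariant, so ergodicity makes it null or
conull. -/
theorem bddAbove_maxBirkhoffSum_comp (x : X) :
    BddAbove (Set.range fun N => maxBirkhoffSum T f N (T x)) ↔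
      BddAbove (Set.range fun N => maxBirkhoffSum T f N x) := by
  constructor
  · rintro ⟨C, hC⟩
    refine ⟨max 0 (f x + C), ?_⟩
    rintro _ ⟨N, rfl⟩
    refine (maxBirkhoffSum_le_succ N x).trans ?_
    rw [maxBirkhoffSum]
    gcongr
    exact hC ⟨N, rfl⟩
  · rintro ⟨C, hC⟩
    refine ⟨C - f x, ?_⟩
    rintro _ ⟨N, rfl⟩
    have h := hC ⟨N + 1, rfl⟩
    simp only [maxBirkhoffSum] at h
    linarith [(le_max_right _ _).trans h]

variable [MeasurableSpace X] {μ : Measure X}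

theorem measurable_maxBirkhoffSum (hT : Measurable T) (hf : Measurable f) (N : ℕ) :
    Measurable (maxBirkhoffSum T f N) := by
  induction N with
  | zero => exact measurable_const
  | succ N ih => exact measurable_const.max (hf.add (ih.comp hT))

theorem integrable_maxBirkhoffSum (hT : MeasurePreserving T μ μ) (hf : Integrable f μ) (N : ℕ) :
    Integrable (maxBirkhoffSum T f N) μ := by
  induction N with
  | zero => exact integrable_zero _ _ _
  | succ N ih => exact (integrable_zero _ _ _).sup (hf.add (hT.integrable_comp_of_integrable ih))

/-- Write `M_N` for the maxima. The differences `M_{N+1} - M_N ∘ T = max (-M_N ∘ T) f` tend to `f`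
where `M_N` is unbounded, while their integrals equal `∫ M_{N+1} - ∫ M_N ≥ 0` by invariance of `μ`.
-/
theorem integral_nonneg_of_maxBirkhoffSum_unbounded (hT : MeasurePreserving T μ μ)
    (hf : Integrable f μ)
    (h : ∀ᵐ x ∂μ, ¬ BddAbove (Set.range fun N => maxBirkhoffSum T f N x)) :
    0 ≤ ∫ x, f x ∂μ := by
  have hMi := integrable_maxBirkhoffSum hT hf
  have hMTi : ∀ N, Integrable (fun x => maxBirkhoffSum T f N (T x)) μ := fun N =>
    hT.integrable_comp_of_integrable (hMi N)
  have hcomp : ∀ N, ∫ x, maxBirkhoffSum T f N (T x) ∂μ = ∫ x, maxBirkhoffSum T f N x ∂μ := by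
    intro N
    have h := integral_map hT.aemeasurable (f := maxBirkhoffSum T f N)
      (hT.map_eq.symm ▸ (hMi N).aestronglyMeasurable)
    rw [← h, hT.map_eq]
  have hlim : Tendsto
      (fun N => ∫ x, (maxBirkhoffSum T f (N + 1) x - maxBirkhoffSum T f N (T x)) ∂μ) atTop
      (𝓝 (∫ x, f x ∂μ)) := by
    refine tendsto_integral_of_dominated_convergence (fun x => |f x|)
      (fun N => ((hMi (N + 1)).sub (hMTi N)).aestronglyMeasurable) hf.abs ?_ ?_
    -- If the maximum is `0`, the difference `-M_N (T x)` lies between `f x` and `0`; otherwise it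
    -- equals `f x`.
    · refine fun N => Eventually.of_forall fun x => ?_
      have h0 := maxBirkhoffSum_nonneg (T := T) (f := f) N (T x)
      rw [Real.norm_eq_abs, maxBirkhoffSum]
      rcases max_cases 0 (f x + maxBirkhoffSum T f N (T x)) with h | h <;> rw [h.1]
      · rw [abs_of_nonpos (by linarith), abs_of_nonpos (by linarith)]
        linarith
      · simp
    · filter_upwards [h] with x hx
      rw [← bddAbove_maxBirkhoffSum_comp] at hx
      have hmono : Monotone fun N => maxBirkhoffSum T f N (T x) :=
        monotone_nat_of_le_succ fun N => maxBirkhoffSum_le_succ N _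
      have htop := tendsto_atTop_atTop_of_monotone' hmono hx
      refine tendsto_const_nhds.congr' ?_
      filter_upwards [htop.eventually_ge_atTop (-f x)] with N hN
      rw [maxBirkhoffSum, max_eq_right (by linarith)]
      ring
  refine ge_of_tendsto' hlim fun N => ?_
  rw [integral_sub (hMi (N + 1)) (hMTi N),
    hcomp N, sub_nonneg]
  exact integral_mono (hMi N) (hMi (N + 1)) fun x => maxBirkhoffSum_le_succ N x


theorem ae_bddAbove_birkhoffSum (hT : Ergodic T μ) (hfm : Measurable f) (hf : Integrable f μ)
    (hneg : ∫ x, f x ∂μ < 0) :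
    ∀ᵐ x ∂μ, ∃ C, ∀ n, birkhoffSum T f n x ≤ C := by
  have hmeas : MeasurableSet {x | BddAbove (Set.range fun N => maxBirkhoffSum T f N x)} :=
    measurableSet_bddAbove_range fun N => measurable_maxBirkhoffSum hT.measurable hfm N
  rcases hT.toPreErgodic.ae_mem_or_ae_notMem hmeas
    (Set.ext fun x => bddAbove_maxBirkhoffSum_comp x) with h | h
  · filter_upwards [h] with x hx
    obtain ⟨C, hC⟩ := hx
    exact ⟨C, fun n => (birkhoffSum_le_maxBirkhoffSum n x).trans (hC ⟨n, rfl⟩)⟩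
  · exact absurd (integral_nonneg_of_maxBirkhoffSum_unbounded hT.toMeasurePreserving hf h)
      (not_le.2 hneg)

theorem ae_eventually_birkhoffAverage_lt [IsProbabilityMeasure μ] (hT : Ergodic T μ)
    (hfm : Measurable f) (hf : Integrable f μ) {ε : ℝ} (hε : 0 < ε) :
    ∀ᵐ x ∂μ, ∀ᶠ n in atTop, birkhoffAverage ℝ T f n x < ∫ x, f x ∂μ + ε := by
  have hint : ∫ x, (f x - (∫ x, f x ∂μ + ε / 2)) ∂μ = -(ε / 2) := by
    rw [integral_sub hf (integrable_const _)]
    simp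
  -- Half of `ε` makes the shifted integral negative; the other half absorbs the error `C / n`.
  filter_upwards [ae_bddAbove_birkhoffSum hT (hfm.sub_const (∫ x, f x ∂μ + ε / 2))
    (hf.sub (integrable_const _)) (by rw [hint]; linarith)] with x hx
  obtain ⟨C, hC⟩ := hx
  have hlim : Tendsto (fun n : ℕ => C / n) atTop (𝓝 0) := tendsto_const_div_atTop_nhds_zero_nat C
  filter_upwards [hlim.eventually_lt_const (half_pos hε), eventually_gt_atTop 0] with n hn hn0
  have h := hC n
  have hn' : (0 : ℝ) < n := by exact_mod_cast hn0
  simp only [birkhoffSum, Finset.sum_sub_distrib, Finset.sum_const, Finset.card_range,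
    nsmul_eq_mul] at h
  rw [birkhoffAverage, birkhoffSum, smul_eq_mul, inv_mul_eq_div, div_lt_iff₀ hn']
  rw [div_lt_iff₀ hn'] at hn
  linarith

/-- Birkhoff's pointwise ergodic theorem for real-valued functions. -/
theorem tendsto_birkhoffAverage_real [IsProbabilityMeasure μ] (hT : Ergodic T μ)
    (hfm : Measurable f) (hf : Integrable f μ) :
    ∀ᵐ x ∂μ, Tendsto (birkhoffAverage ℝ T f · x) atTop (𝓝 (∫ x, f x ∂μ)) := by
  have hpos : ∀ m : ℕ, (0 : ℝ) < 1 / (m + 1) := fun m => Nat.one_div_pos_of_nat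
  filter_upwards [ae_all_iff.2 fun m => ae_eventually_birkhoffAverage_lt hT hfm hf (hpos m),
    ae_all_iff.2 fun m => ae_eventually_birkhoffAverage_lt hT hfm.neg hf.neg (hpos m)] with x h1 h2
  refine tendsto_order.2 ⟨fun a ha => ?_, fun a ha => ?_⟩
  · obtain ⟨m, hm⟩ := exists_nat_one_div_lt (sub_pos.2 ha)
    filter_upwards [h2 m] with n hn
    rw [birkhoffAverage_neg] at hn
    simp only [Pi.neg_apply, integral_neg] at hn
    linarith
  · obtain ⟨m, hm⟩ := exists_nat_one_div_lt (sub_pos.2 ha)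
    filter_upwards [h1 m] with n hn
    linarith

/-- Birkhoff's pointwise ergodic theorem for real- or complex-valued functions. -/
theorem tendsto_birkhoffAverage {𝕜 : Type*} [RCLike 𝕜] [IsProbabilityMeasure μ]
    (hT : Ergodic T μ) {f : X → 𝕜} (hf : Integrable f μ) :
    ∀ᵐ x ∂μ, Tendsto (birkhoffAverage 𝕜 T f · x) atTop (𝓝 (∫ x, f x ∂μ)) := by
  obtain ⟨g, hgm, hfg⟩ := hf.aestronglyMeasurable
  have hg : Integrable g μ := hf.congr hfg
  have heq : ∀ᵐ x ∂μ, ∀ n, birkhoffAverage 𝕜 T f n x = birkhoffAverage 𝕜 T g n x :=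
    ae_all_iff.2 fun n =>
      hT.toMeasurePreserving.quasiMeasurePreserving.birkhoffAverage_ae_eq_of_ae_eq 𝕜 hfg n
  filter_upwards [heq, tendsto_birkhoffAverage_real hT
    (RCLike.continuous_re.measurable.comp hgm.measurable) hg.re,
    tendsto_birkhoffAverage_real hT
    (RCLike.continuous_im.measurable.comp hgm.measurable) hg.im] with x hx h1 h2
  rw [integral_congr_ae hfg]
  simp only [hx]
  have key := ((RCLike.continuous_ofReal (K := 𝕜)).tendsto _).comp h1 |>.add
    ((((RCLike.continuous_ofReal (K := 𝕜)).tendsto _).comp h2).mul_const RCLike.I)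
  have hint : ((∫ x, RCLike.re (g x) ∂μ : ℝ) : 𝕜) + ((∫ x, RCLike.im (g x) ∂μ : ℝ) : 𝕜) * RCLike.I
      = ∫ x, g x ∂μ := integral_re_add_im hg
  simp only [Function.comp_def] at key
  rw [hint] at key
  refine key.congr fun n => ?_
  simp only [birkhoffAverage, birkhoffSum, smul_eq_mul]
  push_cast
  rw [mul_assoc, ← mul_add, Finset.sum_mul, ← Finset.sum_add_distrib]
  simp only [RCLike.re_add_im]

/-- Birkhoff's pointwise ergodic theorem for `[0, ∞]`-valued functions of finite integral. -/
theorem tendsto_ennreal_average [IsProbabilityMeasure μ] (hT : Ergodic T μ) {h : X → ℝ≥0∞}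
    (hm : Measurable h) (hh : ∫⁻ x, h x ∂μ ≠ ∞) :
    ∀ᵐ x ∂μ, Tendsto (fun n : ℕ => (∑ k ∈ Finset.range n, h (T^[k] x)) / n) atTop
      (𝓝 (∫⁻ x, h x ∂μ)) := by
  have hint : Integrable (fun x => (h x).toReal) μ := integrable_toReal_of_lintegral_ne_top
    hm.aemeasurable hh
  have hfin := ae_lt_top hm hh
  have hfin' : ∀ᵐ x ∂μ, ∀ k, h (T^[k] x) < ∞ := ae_all_iff.2 fun k =>
    (hT.toMeasurePreserving.iterate k).quasiMeasurePreserving.ae hfin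
  filter_upwards [hfin', tendsto_birkhoffAverage hT hint] with x hx hlim
  rw [integral_toReal hm.aemeasurable hfin] at hlim
  have h2 := (ENNReal.continuous_ofReal.tendsto _).comp hlim
  rw [ENNReal.ofReal_toReal hh] at h2
  refine h2.congr' ?_
  filter_upwards [eventually_gt_atTop 0] with n hn
  simp only [Function.comp_apply, birkhoffAverage, birkhoffSum, smul_eq_mul]
  rw [inv_mul_eq_div, ENNReal.ofReal_div_of_pos (by exact_mod_cast hn), ENNReal.ofReal_natCast,
    ENNReal.ofReal_sum_of_nonneg fun _ _ => ENNReal.toReal_nonneg]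
  congr 1
  exact Finset.sum_congr rfl fun k _ => ENNReal.ofReal_toReal (hx k).ne

end Birkhoff

/-! ### The mean ergodic theorem in `L_p` -/

section MeanErgodic

variable {𝕜 X : Type*} [RCLike 𝕜] [MeasurableSpace X] {μ : Measure X} {T : X → X}
  {p : ℝ≥0∞} [Fact (1 ≤ p)]

/-- The average `n⁻¹ ∑_{k < n} V^k` of the powers of the Koopman operator. -/
def koopmanAverage (hT : MeasurePreserving T μ μ) (n : ℕ) : Lp 𝕜 p μ →L[𝕜] Lp 𝕜 p μ :=
  (n : 𝕜)⁻¹ • ∑ k ∈ Finset.range n, koopman hT ^ k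

theorem koopman_pow_apply (hT : MeasurePreserving T μ μ) (k : ℕ) (f : Lp 𝕜 p μ) :
    (koopman hT ^ k : Lp 𝕜 p μ →L[𝕜] Lp 𝕜 p μ) f
      = Lp.compMeasurePreserving T^[k] (hT.iterate k) f := by
  rw [← Lp.compMeasurePreserving_iterate hT, FunLike.coe_pow_eq_iterate]
  rfl

theorem coeFn_koopmanAverage (hT : MeasurePreserving T μ μ) (n : ℕ) (f : Lp 𝕜 p μ) :
    koopmanAverage hT n f =ᵐ[μ] birkhoffAverage 𝕜 T f n := by
  have h1 : koopmanAverage hT n f = (n : 𝕜)⁻¹ • ∑ k ∈ Finset.range n,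
      Lp.compMeasurePreserving T^[k] (hT.iterate k) f := by
    simp only [koopmanAverage, smul_apply, sum_apply, koopman_pow_apply]
  rw [h1]
  refine (Lp.coeFn_smul _ _).trans ?_
  filter_upwards [Lp.coeFn_finsetSum (Finset.range n)
      (fun k => Lp.compMeasurePreserving T^[k] (hT.iterate k) f),
    ae_all_iff.2 fun k => Lp.coeFn_compMeasurePreserving f (hT.iterate k)] with x h2 h3
  rw [Pi.smul_apply, h2, Finset.sum_apply]
  simp only [h3, birkhoffAverage, birkhoffSum, Function.comp_apply]

theorem norm_koopmanAverage_le (hT : MeasurePreserving T μ μ) (n : ℕ) :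
    ‖(koopmanAverage hT n : Lp 𝕜 p μ →L[𝕜] Lp 𝕜 p μ)‖ ≤ 1 := by
  refine ContinuousLinearMap.opNorm_le_bound _ zero_le_one fun f => ?_
  have h : ‖∑ k ∈ Finset.range n, (koopman hT ^ k : Lp 𝕜 p μ →L[𝕜] Lp 𝕜 p μ) f‖ ≤ n * ‖f‖ := by
    refine (norm_sum_le_of_le (Finset.range n) (f := fun k =>
      (koopman hT ^ k : Lp 𝕜 p μ →L[𝕜] Lp 𝕜 p μ) f) (n := fun _ => ‖f‖) fun k _ => ?_).trans ?_
    · rw [koopman_pow_apply, Lp.norm_compMeasurePreserving]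
    · simp
  simp only [koopmanAverage, smul_apply, sum_apply]
  rw [norm_smul, norm_inv, RCLike.norm_natCast, one_mul]
  rcases n.eq_zero_or_pos with rfl | hn
  · simp
  · rwa [inv_mul_le_iff₀ (by exact_mod_cast hn)]

/-- The mean ergodic theorem in `L_p`, `1 ≤ p < ∞`, for an ergodic transformation. -/
theorem tendsto_koopmanAverage [IsProbabilityMeasure μ] (hT : Ergodic T μ) (hp : p ≠ ∞)
    (f : Lp 𝕜 p μ) :
    Tendsto (fun n => koopmanAverage hT.toMeasurePreserving n f) atTop
      (𝓝 (Lp.const p μ (∫ x, f x ∂μ))) := by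
  have hp1 : 1 ≤ p := Fact.out
  have hfm : MemLp f p μ := Lp.memLp f
  -- The iterates are identically distributed, so their `p`-th powers, and those of their averages,
  -- are uniformly integrable; Vitali's theorem upgrades almost sure convergence to `L_p`.
  have hident : ∀ k, ProbabilityTheory.IdentDistrib (fun x => f (T^[k] x))
      (fun x => f (T^[0] x)) μ μ := fun k => by
    have hk := hT.toMeasurePreserving.iterate k
    have hsm : Measurable f := (Lp.stronglyMeasurable f).measurable
    refine ⟨(hsm.comp hk.measurable).aemeasurable, hsm.aemeasurable, ?_⟩
    change Measure.map (f ∘ T^[k]) μ = Measure.map f μ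
    rw [← Measure.map_map hsm hk.measurable, hk.map_eq]
  have hui := (uniformIntegrable_average hp1
    (ProbabilityTheory.MemLp.uniformIntegrable_of_identDistrib (j := 0) hp1 hp hfm hident)).unifIntegrable
  have heq : ∀ n : ℕ, (n : ℝ)⁻¹ • ∑ i ∈ Finset.range n, (fun x => f (T^[i] x))
      = birkhoffAverage 𝕜 T f n := fun n => by
    ext x
    simp [birkhoffAverage, birkhoffSum, RCLike.real_smul_eq_coe_mul]
  simp only [heq] at hui
  have hmeas : ∀ n, AEStronglyMeasurable (birkhoffAverage 𝕜 T f n) μ := fun n =>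
    (Lp.aestronglyMeasurable _).congr (coeFn_koopmanAverage hT.toMeasurePreserving n f)
  have hconv := tendsto_Lp_finite_of_tendsto_ae hp1 hp hmeas
    (memLp_const (∫ x, f x ∂μ)) hui (tendsto_birkhoffAverage hT (hfm.integrable hp1))
  rw [Lp.tendsto_Lp_iff_tendsto_eLpNorm']
  refine hconv.congr fun n => eLpNorm_congr_ae ?_
  filter_upwards [coeFn_koopmanAverage hT.toMeasurePreserving n f,
    Lp.coeFn_const p μ (∫ x, f x ∂μ)] with x h1 h2
  simp [h1]

end MeanErgodic

/-! ### The statistics of elementary tensors -/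

section Statistics

variable {𝕜 X : Type*} [RCLike 𝕜] [MeasurableSpace X] {μ : Measure X} {T : X → X}
  {p r : ℝ≥0∞} [Fact (1 ≤ p)] [Fact (1 ≤ r)] {d : ℕ}

/-- The multilinear map `(f₁, …, f_d) ↦ f₁ ⋯ f_d` from `L_p(μ)^d` to `L_r(μ)`, `r = p/d`. -/
def mulMultilinear (𝕜 : Type*) [RCLike 𝕜] {X : Type*} [MeasurableSpace X] (μ : Measure X)
    {p r : ℝ≥0∞} [Fact (1 ≤ p)] [Fact (1 ≤ r)] {d : ℕ} (hr : r = p / d) :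
    ContinuousMultilinearMap 𝕜 (fun _ : Fin d => Lp 𝕜 p μ) (Lp 𝕜 r μ) :=
  prodCompMultilinear (fun _ => id) (fun _ => MeasurePreserving.id μ)
    (eLpNorm_prodComp_diag_le (zero_lt_one.trans_le Fact.out).ne' hr)

theorem coeFn_mulMultilinear (hr : r = p / d) (f : Fin d → Lp 𝕜 p μ) :
    mulMultilinear 𝕜 μ hr f =ᵐ[μ] fun x => ∏ i, f i x :=
  MemLp.coeFn_toLp (memLp_prodComp (fun _ => MeasurePreserving.id μ)
    (eLpNorm_prodComp_diag_le (zero_lt_one.trans_le Fact.out).ne' hr) f)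

theorem norm_mulMultilinear_le (hr : r = p / d) : ‖mulMultilinear 𝕜 μ hr‖ ≤ 1 := by
  refine ContinuousMultilinearMap.opNorm_le_bound zero_le_one fun f => ?_
  simp only [one_mul, Lp.norm_def]
  rw [← ENNReal.toReal_prod, eLpNorm_congr_ae (coeFn_mulMultilinear hr f)]
  exact ENNReal.toReal_mono (ENNReal.prod_lt_top fun i _ => Lp.eLpNorm_lt_top (f i)).ne
    (eLpNorm_prodComp_diag_le (zero_lt_one.trans_le Fact.out).ne' hr f)

/-- The von Mises statistic as a continuous linear operator. -/
def vStatL (hT : MeasurePreserving T μ μ) (hr : r = p / d) (n : ℕ) :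
    LpProj 𝕜 μ p d →L[𝕜] Lp 𝕜 r μ :=
  ((n : 𝕜) ^ d)⁻¹ • ∑ k ∈ Fintype.piFinset (fun _ : Fin d => Finset.range n),
    (restrD hr).comp (koopmanProj hT k)

theorem vStat_eq (hT : MeasurePreserving T μ μ) (hr : r = p / d) (f : LpProj 𝕜 μ p d) (n : ℕ) :
    vStat hT hr f n = vStatL hT hr n f := by
  simp [vStat, vStatL]

/-- Multilinearity collapses the sum over `n^d` indices, one factor `1/n` going to each slot. -/
theorem vStatL_coe (hT : MeasurePreserving T μ μ) (hr : r = p / d) (n : ℕ)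
    (t : AlgTensorPower 𝕜 μ p d) :
    vStatL hT hr n (t : LpProj 𝕜 μ p d) = PiTensorProduct.lift
      ((mulMultilinear 𝕜 μ hr).compContinuousLinearMap
        fun _ => koopmanAverage hT n).toMultilinearMap t := by
  induction t using PiTensorProduct.induction_on with
  | smul_tprod c f =>
    rw [UniformSpace.Completion.coe_smul, map_smul, map_smul]
    congr 1
    have h1 : ∀ k : Fin d → ℕ, restrD hr (koopmanProj hT k
        ((PiTensorProduct.tprod 𝕜 f : AlgTensorPower 𝕜 μ p d) : LpProj 𝕜 μ p d))
        = mulMultilinear 𝕜 μ hr fun i =>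
          (koopman hT ^ k i : Lp 𝕜 p μ →L[𝕜] Lp 𝕜 p μ) (f i) := by
      intro k
      rw [koopmanProj, ContinuousLinearMap.completion_apply_coe, restrD,
        ContinuousLinearMap.fromCompletion_apply_coe, PiTensorProduct.mapL_apply,
        PiTensorProduct.map_tprod, PiTensorProduct.liftIsometry_apply_apply,
        PiTensorProduct.lift.tprod]
      rfl
    rw [PiTensorProduct.lift.tprod]
    simp only [vStatL, smul_apply, sum_apply,
      ContinuousLinearMap.comp_apply, h1]
    rw [← (mulMultilinear 𝕜 μ hr).map_sum_finset
      (fun i k => (koopman hT ^ k : Lp 𝕜 p μ →L[𝕜] Lp 𝕜 p μ) (f i)) fun _ => Finset.range n]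
    have h2 := (mulMultilinear 𝕜 μ hr).map_smul_univ (fun _ => (n : 𝕜)⁻¹)
      fun i => ∑ k ∈ Finset.range n, (koopman hT ^ k : Lp 𝕜 p μ →L[𝕜] Lp 𝕜 p μ) (f i)
    rw [Finset.prod_const, Finset.card_univ, Fintype.card_fin, inv_pow] at h2
    rw [← h2]
    simp [koopmanAverage]
  | add a b ha hb =>
    rw [UniformSpace.Completion.coe_add, map_add, map_add, ha, hb]

theorem vStatL_tprod (hT : MeasurePreserving T μ μ) (hr : r = p / d) (n : ℕ)
    (f : Fin d → Lp 𝕜 p μ) :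
    vStatL hT hr n ((PiTensorProduct.tprod 𝕜 f : AlgTensorPower 𝕜 μ p d) : LpProj 𝕜 μ p d)
      = mulMultilinear 𝕜 μ hr fun i => koopmanAverage hT n (f i) := by
  rw [vStatL_coe, PiTensorProduct.lift.tprod]
  rfl

/-- By the universal property of the projective norm, it is enough that the product map and each
average are contractions. -/
theorem norm_vStatL_le (hT : MeasurePreserving T μ μ) (hr : r = p / d) (n : ℕ) :
    ‖(vStatL hT hr n : LpProj 𝕜 μ p d →L[𝕜] Lp 𝕜 r μ)‖ ≤ 1 := by
  refine ContinuousLinearMap.opNorm_le_bound _ zero_le_one fun f => ?_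
  rw [one_mul]
  induction f using UniformSpace.Completion.induction_on with
  | hp => exact isClosed_le (by fun_prop) (by fun_prop)
  | ih t =>
    rw [vStatL_coe, UniformSpace.Completion.norm_coe]
    refine (PiTensorProduct.norm_eval_le_projectiveSeminorm _ t).trans ?_
    refine mul_le_of_le_one_left (norm_nonneg _) ?_
    refine (ContinuousMultilinearMap.norm_compContinuousLinearMap_le _ _).trans ?_
    exact mul_le_one₀ (norm_mulMultilinear_le hr) (by positivity)
      (Finset.prod_le_one (fun _ _ => norm_nonneg _) fun _ _ => norm_koopmanAverage_le hT n)

theorem integral_embJ_tprod [IsProbabilityMeasure μ] (f : Fin d → Lp 𝕜 p μ) :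
    ∫ y, embJ ((PiTensorProduct.tprod 𝕜 f : AlgTensorPower 𝕜 μ p d) : LpProj 𝕜 μ p d) y
      ∂(Measure.pi fun _ : Fin d => μ) = ∏ i, ∫ x, f i x ∂μ := by
  rw [embJ, ContinuousLinearMap.fromCompletion_apply_coe,
    PiTensorProduct.liftIsometry_apply_apply, PiTensorProduct.lift.tprod,
    ← integral_fintype_prod_eq_prod]
  exact integral_congr_ae (MemLp.coeFn_toLp (memLp_prodComp
    (fun i => measurePreserving_eval (fun _ : Fin d => μ) i)
    (eLpNorm_prodComp_eval_le (zero_lt_one.trans_le Fact.out).ne') f))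

theorem tendsto_vStatL_tprod_ae [IsProbabilityMeasure μ] (hT : Ergodic T μ) (hr : r = p / d)
    (f : Fin d → Lp 𝕜 p μ) :
    ∀ᵐ x ∂μ, Tendsto (fun n => vStatL hT.toMeasurePreserving hr n
      ((PiTensorProduct.tprod 𝕜 f : AlgTensorPower 𝕜 μ p d) : LpProj 𝕜 μ p d) x) atTop
      (𝓝 (∏ i, ∫ x, f i x ∂μ)) := by
  have h1 : ∀ᵐ x ∂μ, ∀ n, vStatL hT.toMeasurePreserving hr n
      ((PiTensorProduct.tprod 𝕜 f : AlgTensorPower 𝕜 μ p d) : LpProj 𝕜 μ p d) x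
      = ∏ i, koopmanAverage hT.toMeasurePreserving n (f i) x := ae_all_iff.2 fun n => by
    rw [vStatL_tprod]
    exact coeFn_mulMultilinear hr _
  filter_upwards [h1, ae_all_iff.2 fun i => ae_all_iff.2 fun n =>
      coeFn_koopmanAverage hT.toMeasurePreserving n (f i),
    ae_all_iff.2 fun i => tendsto_birkhoffAverage hT ((Lp.memLp (f i)).integrable Fact.out)]
    with x h1 h2 h3
  simp only [h1, h2]
  exact tendsto_finsetProd _ fun i _ => h3 i

theorem tendsto_vStatL_tprod [IsProbabilityMeasure μ] (hT : Ergodic T μ) (hr : r = p / d)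
    (hp : p ≠ ∞) (f : Fin d → Lp 𝕜 p μ) :
    Tendsto (fun n => vStatL hT.toMeasurePreserving hr n
      ((PiTensorProduct.tprod 𝕜 f : AlgTensorPower 𝕜 μ p d) : LpProj 𝕜 μ p d)) atTop
      (𝓝 (Lp.const r μ (∏ i, ∫ x, f i x ∂μ))) := by
  have h := ((mulMultilinear 𝕜 μ hr).cont.tendsto _).comp
    (tendsto_pi_nhds.2 fun i => tendsto_koopmanAverage hT hp (f i))
  have hconst : mulMultilinear 𝕜 μ hr (fun i => Lp.const p μ (∫ x, f i x ∂μ))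
      = Lp.const r μ (∏ i, ∫ x, f i x ∂μ) := by
    refine Lp.ext ?_
    filter_upwards [coeFn_mulMultilinear hr fun i => Lp.const p μ (∫ x, f i x ∂μ),
      Lp.coeFn_const r μ (∏ i, ∫ x, f i x ∂μ),
      ae_all_iff.2 fun i => Lp.coeFn_const p μ (∫ x, f i x ∂μ)] with x h1 h2 h3
    rw [h1, h2]
    simp only [h3, Function.const_apply]
  rw [← hconst]
  exact h.congr fun n => (vStatL_tprod _ hr n f).symm

end Statistics

/-! ### Domination by ergodic averages -/

section Domination

/-- Bound every factor by the largest; the constant lost against the arithmetic-geometric mean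
inequality is harmless. -/
theorem ennreal_prod_le_sum_pow {d : ℕ} (hd : d ≠ 0) (a : Fin d → ℝ≥0∞) :
    ∏ i, a i ≤ ∑ i, a i ^ d := by
  have : Nonempty (Fin d) := ⟨⟨0, Nat.pos_of_ne_zero hd⟩⟩
  obtain ⟨j, hj⟩ := Finite.exists_max a
  calc ∏ i, a i ≤ ∏ _i : Fin d, a j := Finset.prod_le_prod' fun i _ => hj i
    _ = a j ^ d := by simp
    _ ≤ ∑ i, a i ^ d := Finset.single_le_sum (f := fun i => a i ^ d) (fun _ _ => zero_le)
        (Finset.mem_univ j)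

theorem ennreal_average_pow_le {d : ℕ} (hd : d ≠ 0) (n : ℕ) (a : ℕ → ℝ≥0∞) :
    ((∑ k ∈ Finset.range n, a k) / n) ^ d ≤ (∑ k ∈ Finset.range n, a k ^ d) / n := by
  rcases n.eq_zero_or_pos with rfl | hn
  · simp [hd]
  have hn0 : (n : ℝ≥0∞) ≠ 0 := by exact_mod_cast hn.ne'
  have h := ENNReal.rpow_arith_mean_le_arith_mean_rpow (Finset.range n) (fun _ => (n : ℝ≥0∞)⁻¹) a
    (by simp [ENNReal.mul_inv_cancel hn0 (ENNReal.natCast_ne_top n)])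
    (p := (d : ℝ)) (by exact_mod_cast Nat.one_le_iff_ne_zero.2 hd)
  simp only [ENNReal.rpow_natCast, ← Finset.mul_sum] at h
  rwa [ENNReal.div_eq_inv_mul, ENNReal.div_eq_inv_mul]

variable {𝕜 X : Type*} [RCLike 𝕜] [MeasurableSpace X] {μ : Measure X} {T : X → X}
  {p r : ℝ≥0∞} [Fact (1 ≤ p)] [Fact (1 ≤ r)] {d : ℕ}

/-- The statistics of `g` are bounded by the ergodic averages of a function of integral at
most `c`. -/
def IsDominated (hT : MeasurePreserving T μ μ) (hr : r = p / d) (g : LpProj 𝕜 μ p d)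
    (c : ℝ≥0∞) : Prop :=
  ∃ h : X → ℝ≥0∞, Measurable h ∧ ∫⁻ x, h x ∂μ ≤ c ∧ ∀ n, ∀ᵐ x ∂μ,
    ‖vStatL hT hr n g x‖ₑ ≤ (∑ k ∈ Finset.range n, h (T^[k] x)) / n

variable {hT : MeasurePreserving T μ μ} {hr : r = p / d} {g g' : LpProj 𝕜 μ p d} {c c' : ℝ≥0∞}

theorem IsDominated.mono (h : IsDominated hT hr g c) (hc : c ≤ c') : IsDominated hT hr g c' :=
  let ⟨u, hm, hi, hb⟩ := h
  ⟨u, hm, hi.trans hc, hb⟩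

theorem isDominated_zero : IsDominated hT hr (0 : LpProj 𝕜 μ p d) c := by
  refine ⟨0, measurable_const, by simp, fun n => ?_⟩
  rw [map_zero]
  filter_upwards [Lp.coeFn_zero 𝕜 r μ] with x hx
  rw [hx]
  simp

theorem IsDominated.add (h : IsDominated hT hr g c) (h' : IsDominated hT hr g' c') :
    IsDominated hT hr (g + g') (c + c') := by
  obtain ⟨u, hm, hi, hb⟩ := h
  obtain ⟨u', hm', hi', hb'⟩ := h'
  refine ⟨fun x => u x + u' x, hm.add hm', ?_, fun n => ?_⟩
  · rw [lintegral_add_left hm]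
    exact add_le_add hi hi'
  · rw [map_add]
    filter_upwards [hb n, hb' n, Lp.coeFn_add (vStatL hT hr n g) (vStatL hT hr n g')]
      with x h1 h2 h3
    rw [h3, Finset.sum_add_distrib, ENNReal.add_div]
    exact (enorm_add_le _ _).trans (add_le_add h1 h2)

theorem IsDominated.smul (h : IsDominated hT hr g c) (a : 𝕜) :
    IsDominated hT hr (a • g) (‖a‖ₑ * c) := by
  obtain ⟨u, hm, hi, hb⟩ := h
  refine ⟨fun x => ‖a‖ₑ * u x, hm.const_mul _, ?_, fun n => ?_⟩
  · rw [lintegral_const_mul _ hm]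
    gcongr
  · rw [map_smul]
    filter_upwards [hb n, Lp.coeFn_smul a (vStatL hT hr n g)] with x h1 h3
    rw [h3, ← Finset.mul_sum, Pi.smul_apply, enorm_smul, mul_div_assoc]
    gcongr

/-- The sum of the dominating functions works. For fixed `n`, continuity of the statistic gives
`L_r` convergence of the partial sums, hence almost sure convergence along a subsequence, which
preserves the bound. -/
theorem isDominated_tsum {v : ℕ → LpProj 𝕜 μ p d} {b : ℕ → ℝ≥0∞}
    (hv : Tendsto (fun N => ∑ j ∈ Finset.range (N + 1), v j) atTop (𝓝 g))
    (h : ∀ j, IsDominated hT hr (v j) (b j)) : IsDominated hT hr g (∑' j, b j) := by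
  choose u hm hi hb using h
  refine ⟨fun x => ∑' j, u j x, Measurable.tsum hm, ?_, fun n => ?_⟩
  · rw [lintegral_tsum fun j => (hm j).aemeasurable]
    exact ENNReal.tsum_le_tsum hi
  have hlim := ((vStatL hT hr n).continuous.tendsto g).comp hv
  obtain ⟨φ, -, hφ⟩ := (tendstoInMeasure_of_tendsto_Lp hlim).exists_seq_tendsto_ae
  have hsum : ∀ᵐ x ∂μ, ∀ N, vStatL hT hr n (∑ j ∈ Finset.range (N + 1), v j) x
      = ∑ j ∈ Finset.range (N + 1), vStatL hT hr n (v j) x := ae_all_iff.2 fun N => by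
    rw [map_sum]
    filter_upwards [Lp.coeFn_finsetSum (Finset.range (N + 1)) fun j => vStatL hT hr n (v j)]
      with x hx
    rw [hx, Finset.sum_apply]
  filter_upwards [hφ, hsum, ae_all_iff.2 fun j => hb j n] with x h1 h2 h3
  refine le_of_tendsto' h1.enorm fun N => ?_
  rw [Function.comp_apply, h2]
  refine (enorm_sum_le _ _).trans ((Finset.sum_le_sum fun j _ => h3 j).trans ?_)
  simp only [div_eq_mul_inv]
  rw [← Finset.sum_mul, Finset.sum_comm]
  gcongr
  exact ENNReal.sum_le_tsum _

/-- This is where `d ≤ p` enters: `‖f‖_d ≤ ‖f‖_p` on a probability space. -/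
theorem lintegral_enorm_pow_le [IsProbabilityMeasure μ] (hd : d ≠ 0) (hdp : (d : ℝ≥0∞) ≤ p)
    (f : Lp 𝕜 p μ) : ∫⁻ x, ‖f x‖ₑ ^ d ∂μ ≤ ‖f‖ₑ ^ d := by
  have hd' : (d : ℝ) ≠ 0 := by exact_mod_cast hd
  have h := eLpNorm_le_eLpNorm_of_exponent_le hdp (Lp.aestronglyMeasurable f)
  rw [eLpNorm_eq_lintegral_rpow_enorm_toReal (by exact_mod_cast hd) (ENNReal.natCast_ne_top d),
    ← Lp.enorm_def] at h
  simp only [ENNReal.toReal_natCast, ENNReal.rpow_natCast] at h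
  have h2 := pow_le_pow_left' h d
  rwa [← ENNReal.rpow_natCast (_ ^ _), ← ENNReal.rpow_mul, one_div, inv_mul_cancel₀ hd',
    ENNReal.rpow_one] at h2

theorem isDominated_tprod_of_norm_le_one [IsProbabilityMeasure μ] (hd : d ≠ 0)
    (hdp : (d : ℝ≥0∞) ≤ p) (f : Fin d → Lp 𝕜 p μ) (hf : ∀ i, ‖f i‖ₑ ≤ 1) :
    IsDominated hT hr
      ((PiTensorProduct.tprod 𝕜 f : AlgTensorPower 𝕜 μ p d) : LpProj 𝕜 μ p d) d := by
  have hm : ∀ i, Measurable fun x => ‖f i x‖ₑ ^ d := fun i =>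
    (Lp.stronglyMeasurable (f i)).enorm.pow_const _
  refine ⟨fun x => ∑ i, ‖f i x‖ₑ ^ d, Finset.measurable_fun_sum _ fun i _ => hm i, ?_,
    fun n => ?_⟩
  · rw [lintegral_finsetSum _ fun i _ => hm i]
    calc ∑ i, ∫⁻ x, ‖f i x‖ₑ ^ d ∂μ ≤ ∑ _i : Fin d, 1 := Finset.sum_le_sum fun i _ =>
          (lintegral_enorm_pow_le hd hdp (f i)).trans (pow_le_one' (hf i) d)
      _ = d := by simp
  · rw [vStatL_tprod]
    filter_upwards [coeFn_mulMultilinear hr fun i => koopmanAverage hT n (f i),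
      ae_all_iff.2 fun i => coeFn_koopmanAverage hT n (f i)] with x h1 h2
    rw [h1, enorm_finset_prod]
    have hA : ∀ i, ‖koopmanAverage hT n (f i) x‖ₑ
        ≤ (∑ k ∈ Finset.range n, ‖f i (T^[k] x)‖ₑ) / n := by
      intro i
      rw [h2, birkhoffAverage, birkhoffSum]
      rcases n.eq_zero_or_pos with rfl | hn
      · simp
      rw [enorm_smul, enorm_inv (by exact_mod_cast hn.ne'), ENNReal.div_eq_inv_mul]
      have hn' : ‖(n : 𝕜)‖ₑ = n := by
        rw [← ofReal_norm, RCLike.norm_natCast, ENNReal.ofReal_natCast]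
      rw [hn']
      gcongr
      exact enorm_sum_le _ _
    calc ∏ i, ‖koopmanAverage hT n (f i) x‖ₑ
        ≤ ∏ i, (∑ k ∈ Finset.range n, ‖f i (T^[k] x)‖ₑ) / n := Finset.prod_le_prod' fun i _ => hA i
      _ ≤ ∑ i, ((∑ k ∈ Finset.range n, ‖f i (T^[k] x)‖ₑ) / n) ^ d := ennreal_prod_le_sum_pow hd _
      _ ≤ ∑ i, (∑ k ∈ Finset.range n, ‖f i (T^[k] x)‖ₑ ^ d) / n :=
        Finset.sum_le_sum fun i _ => ennreal_average_pow_le hd n _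
      _ = (∑ k ∈ Finset.range n, ∑ i, ‖f i (T^[k] x)‖ₑ ^ d) / n := by
        simp only [div_eq_mul_inv]
        rw [← Finset.sum_mul, Finset.sum_comm]

/-- The bound of a product by a sum of powers is not homogeneous in the separate factors, so each is
first normalized; a zero factor kills the tensor. -/
theorem isDominated_tprod [IsProbabilityMeasure μ] (hd : d ≠ 0) (hdp : (d : ℝ≥0∞) ≤ p)
    (f : Fin d → Lp 𝕜 p μ) :
    IsDominated hT hr
      ((PiTensorProduct.tprod 𝕜 f : AlgTensorPower 𝕜 μ p d) : LpProj 𝕜 μ p d)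
      (d * ENNReal.ofReal (∏ i, ‖f i‖)) := by
  by_cases h0 : ∃ i, f i = 0
  · obtain ⟨i, hi⟩ := h0
    rw [(PiTensorProduct.tprod 𝕜).map_coord_zero i hi, UniformSpace.Completion.coe_zero]
    exact isDominated_zero
  push Not at h0
  have hne : ∀ i, ((‖f i‖ : ℝ) : 𝕜) ≠ 0 := fun i => by
    exact_mod_cast norm_ne_zero_iff.2 (h0 i)
  have hfi : f = fun i => ((‖f i‖ : ℝ) : 𝕜) • (((‖f i‖ : ℝ) : 𝕜)⁻¹ • f i) := by
    ext1 i
    rw [smul_smul, mul_inv_cancel₀ (hne i), one_smul]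
  have hs : PiTensorProduct.tprod 𝕜 f = (∏ i, ((‖f i‖ : ℝ) : 𝕜)) •
      PiTensorProduct.tprod 𝕜 fun i => ((‖f i‖ : ℝ) : 𝕜)⁻¹ • f i := by
    rw [← MultilinearMap.map_smul_univ, ← hfi]
  have hdom := (isDominated_tprod_of_norm_le_one (hT := hT) (hr := hr) hd hdp
    (fun i => ((‖f i‖ : ℝ) : 𝕜)⁻¹ • f i) fun i => by
      rw [← ofReal_norm, norm_smul, norm_inv, RCLike.norm_ofReal, abs_norm,
        inv_mul_cancel₀ (norm_ne_zero_iff.2 (h0 i)), ENNReal.ofReal_one]).smul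
    (∏ i, ((‖f i‖ : ℝ) : 𝕜))
  rw [hs, UniformSpace.Completion.coe_smul]
  refine hdom.mono (le_of_eq ?_)
  rw [mul_comm, ← ofReal_norm, norm_prod]
  simp

theorem isDominated_list_sum [IsProbabilityMeasure μ] (hd : d ≠ 0) (hdp : (d : ℝ≥0∞) ≤ p)
    (l : List (𝕜 × (Fin d → Lp 𝕜 p μ))) :
    IsDominated hT hr
      (((l.map fun z => z.1 • PiTensorProduct.tprod 𝕜 z.2).sum : AlgTensorPower 𝕜 μ p d) :
        LpProj 𝕜 μ p d)
      (d * ENNReal.ofReal (l.map fun z => ‖z.1‖ * ∏ i, ‖z.2 i‖).sum) := by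
  induction l with
  | nil =>
    rw [List.map_nil, List.sum_nil, UniformSpace.Completion.coe_zero]
    exact isDominated_zero
  | cons z l ih =>
    rw [List.map_cons, List.sum_cons, List.map_cons, List.sum_cons,
      UniformSpace.Completion.coe_add, UniformSpace.Completion.coe_smul]
    refine (((isDominated_tprod hd hdp z.2).smul z.1).add ih).mono (le_of_eq ?_)
    rw [ENNReal.ofReal_add (by positivity) (List.sum_nonneg fun a ha => by
      obtain ⟨w, -, rfl⟩ := List.mem_map.1 ha
      positivity), mul_add, ENNReal.ofReal_mul (norm_nonneg _), ofReal_norm,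
      mul_left_comm]

theorem isDominated_coe [IsProbabilityMeasure μ] (hd : d ≠ 0) (hdp : (d : ℝ≥0∞) ≤ p)
    (t : AlgTensorPower 𝕜 μ p d) {a : ℝ} (ht : ‖t‖ < a) :
    IsDominated hT hr (t : LpProj 𝕜 μ p d) (d * ENNReal.ofReal a) := by
  rw [PiTensorProduct.norm_def] at ht
  obtain ⟨⟨l, hl⟩, hlt⟩ := exists_lt_of_ciInf_lt ht
  rw [PiTensorProduct.mem_lifts_iff] at hl
  rw [← hl]
  refine (isDominated_list_sum hd hdp l.toList).mono ?_
  gcongr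
  exact hlt.le

theorem isDominated_of_norm_lt [IsProbabilityMeasure μ] (hd : d ≠ 0) (hdp : (d : ℝ≥0∞) ≤ p)
    {a : ℝ} (hg : ‖g‖ < a) : IsDominated hT hr g (d * ENNReal.ofReal (8 * a)) := by
  have ha : 0 < a := (norm_nonneg g).trans_lt hg
  have hmem : g ∈ closure ((UniformSpace.Completion.toComplₗᵢ (𝕜 := 𝕜)
      (E := AlgTensorPower 𝕜 μ p d)).toLinearMap.range.toAddSubgroup : Set (LpProj 𝕜 μ p d)) := by
    have : ((UniformSpace.Completion.toComplₗᵢ (𝕜 := 𝕜)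
      (E := AlgTensorPower 𝕜 μ p d)).toLinearMap.range.toAddSubgroup : Set (LpProj 𝕜 μ p d))
      = Set.range ((↑) : AlgTensorPower 𝕜 μ p d → LpProj 𝕜 μ p d) := by
      ext y
      simp
    rw [this]
    exact UniformSpace.Completion.denseRange_coe g
  -- Write `g` as a series of algebraic tensors with geometrically decreasing norms.
  obtain ⟨v, hv, hvm, hv0, hvn⟩ := controlled_sum_of_mem_closure hmem
    (b := fun j => a * (1 / 2) ^ j) fun j => by positivity
  -- The term `j = 0` has norm below `2a`, the others below `a / 2^j`; the generous factor `4`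
  -- covers both and sums to `8a`.
  have hnorm : ∀ j, ‖v j‖ < 4 * a * (1 / 2) ^ j := by
    intro j
    have hpos : 0 < a * (1 / 2 : ℝ) ^ j := by positivity
    rcases j.eq_zero_or_pos with rfl | hj
    · have h1 : ‖v 0‖ ≤ ‖-v 0 + g‖ + ‖g‖ := by
        have := norm_sub_le g (-v 0 + g)
        rw [show g - (-v 0 + g) = v 0 by abel] at this
        linarith
      simp only [pow_zero, mul_one] at *
      linarith
    · have := hvn j hj
      linarith
  have hdom : ∀ j, IsDominated hT hr (v j) (d * ENNReal.ofReal (4 * a * (1 / 2) ^ j)) := by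
    intro j
    obtain ⟨t, ht⟩ := hvm j
    have ht' : (t : LpProj 𝕜 μ p d) = v j := ht
    have hj := hnorm j
    rw [← ht', UniformSpace.Completion.norm_coe] at hj
    rw [← ht']
    exact isDominated_coe hd hdp t hj
  refine (isDominated_tsum hv hdom).mono (le_of_eq ?_)
  rw [ENNReal.tsum_mul_left, ← ENNReal.ofReal_tsum_of_nonneg (fun j => by positivity)
    (summable_geometric_two.mul_left _), tsum_mul_left, tsum_geometric_two]
  congr 2
  ring

/-- The dominating averages converge almost surely to the integral of the dominating function, which
is at most `c`. -/
theorem IsDominated.ae_eventually_lt [IsProbabilityMeasure μ] (hT : Ergodic T μ)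
    (h : IsDominated hT.toMeasurePreserving hr g c) (hc : c < c') :
    ∀ᵐ x ∂μ, ∀ᶠ n in atTop, ‖vStatL hT.toMeasurePreserving hr n g x‖ₑ < c' := by
  obtain ⟨u, hm, hi, hb⟩ := h
  filter_upwards [tendsto_ennreal_average hT hm (hi.trans_lt (hc.trans_le le_top)).ne,
    ae_all_iff.2 hb] with x h1 h2
  filter_upwards [h1.eventually_lt_const (hi.trans_lt hc)] with n hn
  exact (h2 n).trans_lt hn

end Domination

/-! ### Convergence -/

section Convergence

variable {𝕜 X : Type*} [RCLike 𝕜] [MeasurableSpace X] {μ : Measure X} [IsProbabilityMeasure μ]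
  {T : X → X} {p r : ℝ≥0∞} [Fact (1 ≤ p)] [Fact (1 ≤ r)] {d : ℕ}

theorem norm_integral_Lp_le {Y : Type*} [MeasurableSpace Y] {ν : Measure Y}
    [IsProbabilityMeasure ν] (g : Lp 𝕜 p ν) : ‖∫ y, g y ∂ν‖ ≤ ‖g‖ := by
  have h1 := enorm_integral_le_lintegral_enorm (μ := ν) g
  rw [← eLpNorm_one_eq_lintegral_enorm] at h1
  have h2 := h1.trans (eLpNorm_le_eLpNorm_of_exponent_le (Fact.out : 1 ≤ p)
    (Lp.aestronglyMeasurable g))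
  rw [← Lp.enorm_def] at h2
  exact enorm_le_iff_norm_le.1 h2

/-- The integral as a continuous linear functional on `L_p` of a probability space. -/
def integralLp (𝕜 : Type*) [RCLike 𝕜] {Y : Type*} [MeasurableSpace Y] (ν : Measure Y)
    [IsProbabilityMeasure ν] (p : ℝ≥0∞) [Fact (1 ≤ p)] : Lp 𝕜 p ν →L[𝕜] 𝕜 :=
  LinearMap.mkContinuous
    { toFun := fun g => ∫ y, g y ∂ν
      map_add' := fun f g => by
        rw [integral_congr_ae (Lp.coeFn_add f g)]
        exact integral_add ((Lp.memLp _).integrable Fact.out) ((Lp.memLp _).integrable Fact.out)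
      map_smul' := fun c f => by
        rw [integral_congr_ae (Lp.coeFn_smul c f)]
        exact integral_smul c (fun y => f y) }
    1 fun f => (norm_integral_Lp_le f).trans_eq (one_mul _).symm

/-- The functional `f ↦ ∫ J_d f dμ^d` on `L_{p,π}(μ^d)`. -/
def integralJ (𝕜 : Type*) [RCLike 𝕜] {X : Type*} [MeasurableSpace X] (μ : Measure X)
    [IsProbabilityMeasure μ] (p : ℝ≥0∞) [Fact (1 ≤ p)] (d : ℕ) : LpProj 𝕜 μ p d →L[𝕜] 𝕜 :=
  (integralLp 𝕜 (Measure.pi fun _ : Fin d => μ) p).comp embJ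

theorem integralJ_apply (f : LpProj 𝕜 μ p d) :
    integralJ 𝕜 μ p d f = ∫ y, embJ f y ∂(Measure.pi fun _ : Fin d => μ) := rfl

theorem integralJ_tprod (f : Fin d → Lp 𝕜 p μ) :
    integralJ 𝕜 μ p d ((PiTensorProduct.tprod 𝕜 f : AlgTensorPower 𝕜 μ p d) : LpProj 𝕜 μ p d)
      = ∏ i, ∫ x, f i x ∂μ :=
  (integralJ_apply _).trans (integral_embJ_tprod f)

theorem tendsto_vStatL_coe_ae (hT : Ergodic T μ) (hr : r = p / d) (t : AlgTensorPower 𝕜 μ p d) :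
    ∀ᵐ x ∂μ, Tendsto (fun n => vStatL hT.toMeasurePreserving hr n (t : LpProj 𝕜 μ p d) x) atTop
      (𝓝 (integralJ 𝕜 μ p d t)) := by
  induction t using PiTensorProduct.induction_on with
  | smul_tprod c f =>
    rw [UniformSpace.Completion.coe_smul, map_smul, integralJ_tprod]
    filter_upwards [tendsto_vStatL_tprod_ae hT hr f, ae_all_iff.2 fun n => Lp.coeFn_smul c
      (vStatL hT.toMeasurePreserving hr n ((PiTensorProduct.tprod 𝕜 f : AlgTensorPower 𝕜 μ p d) :
        LpProj 𝕜 μ p d))] with x h1 h2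
    simp only [map_smul, h2]
    exact h1.const_smul c
  | add a b ha hb =>
    rw [UniformSpace.Completion.coe_add, map_add]
    filter_upwards [ha, hb, ae_all_iff.2 fun n => Lp.coeFn_add
      (vStatL hT.toMeasurePreserving hr n (a : LpProj 𝕜 μ p d))
      (vStatL hT.toMeasurePreserving hr n (b : LpProj 𝕜 μ p d))] with x h1 h2 h3
    simp only [map_add, h3]
    exact h1.add h2

theorem tendsto_vStatL_ae (hT : Ergodic T μ) (hd : d ≠ 0) (hdp : (d : ℝ≥0∞) ≤ p)
    (hr : r = p / d) (f : LpProj 𝕜 μ p d) :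
    ∀ᵐ x ∂μ, Tendsto (fun n => vStatL hT.toMeasurePreserving hr n f x) atTop
      (𝓝 (integralJ 𝕜 μ p d f)) := by
  have hpos : ∀ m : ℕ, (0 : ℝ) < 1 / (m + 1) := fun m => Nat.one_div_pos_of_nat
  have hdpos : (0 : ℝ) < d := by exact_mod_cast Nat.pos_of_ne_zero hd
  have happ : ∀ m : ℕ, ∃ t : AlgTensorPower 𝕜 μ p d,
      ‖f - (t : LpProj 𝕜 μ p d)‖ < 1 / (m + 1) := fun m => by
    obtain ⟨t, ht⟩ := UniformSpace.Completion.denseRange_coe.exists_dist_lt f (hpos m)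
    exact ⟨t, by rwa [← dist_eq_norm]⟩
  choose t ht using happ
  have hdom : ∀ m, ∀ᵐ x ∂μ, ∀ᶠ n in atTop,
      ‖vStatL hT.toMeasurePreserving hr n (f - (t m : LpProj 𝕜 μ p d)) x‖ₑ
        -- Domination gives `8d / (m + 1)`; the `9` provides the strict inequality.
        < ENNReal.ofReal (9 * d * (1 / (m + 1))) := fun m => by
    refine IsDominated.ae_eventually_lt hT (isDominated_of_norm_lt hd hdp (ht m)) ?_
    rw [← ENNReal.ofReal_natCast, ← ENNReal.ofReal_mul hdpos.le]
    refine (ENNReal.ofReal_lt_ofReal_iff (by have := hpos m; positivity)).2 ?_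
    nlinarith [mul_pos hdpos (hpos m)]
  filter_upwards [ae_all_iff.2 hdom, ae_all_iff.2 fun m => tendsto_vStatL_coe_ae hT hr (t m),
    ae_all_iff.2 fun m => ae_all_iff.2 fun n => Lp.coeFn_sub
      (vStatL hT.toMeasurePreserving hr n f) (vStatL hT.toMeasurePreserving hr n (t m))]
    with x h1 h2 h3
  rw [Metric.tendsto_nhds]
  intro ε hε
  -- The three summands are the errors, in units of `1 / (m + 1)`, from replacing `f` by `t m` in
  -- the statistic, from its convergence on `t m`, and from replacing `t m` by `f` in the limit.
  have hK : 0 < 9 * d + 1 + ‖integralJ 𝕜 μ p d‖ := by positivity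
  obtain ⟨m, hm⟩ := exists_nat_one_div_lt (div_pos hε hK)
  rw [lt_div_iff₀ hK] at hm
  filter_upwards [h1 m, Metric.tendsto_nhds.1 (h2 m) _ (hpos m)] with n hn1 hn2
  rw [map_sub, h3, Pi.sub_apply, ← ofReal_norm,
    ENNReal.ofReal_lt_ofReal_iff (by have := hpos m; positivity)] at hn1
  have h4 : dist (integralJ 𝕜 μ p d (t m)) (integralJ 𝕜 μ p d f)
      ≤ ‖integralJ 𝕜 μ p d‖ * (1 / (m + 1)) := by
    rw [dist_eq_norm, ← map_sub]
    refine ((integralJ 𝕜 μ p d).le_opNorm _).trans ?_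
    gcongr
    rw [norm_sub_rev]
    exact (ht m).le
  rw [← dist_eq_norm] at hn1
  have h5 := dist_triangle4 (vStatL hT.toMeasurePreserving hr n f x)
    (vStatL hT.toMeasurePreserving hr n (t m) x) (integralJ 𝕜 μ p d (t m))
    (integralJ 𝕜 μ p d f)
  linarith

theorem tendsto_vStatL (hT : Ergodic T μ) (hp : p ≠ ∞) (hr : r = p / d) (f : LpProj 𝕜 μ p d) :
    Tendsto (fun n => vStatL hT.toMeasurePreserving hr n f) atTop
      (𝓝 (Lp.const r μ (integralJ 𝕜 μ p d f))) := by
  induction f using UniformSpace.Completion.induction_on with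
  | hp =>
    -- A uniform Lipschitz bound gives equicontinuity, so with a continuous limit the set of `f`
    -- where convergence holds is closed.
    have hlip : ∀ n, LipschitzWith 1
        fun f : LpProj 𝕜 μ p d => vStatL hT.toMeasurePreserving hr n f := fun n => by
      refine LipschitzWith.of_dist_le_mul fun f g => ?_
      rw [NNReal.coe_one, dist_eq_norm, ← map_sub, dist_eq_norm]
      exact ContinuousLinearMap.le_of_opNorm_le _ (norm_vStatL_le hT.toMeasurePreserving hr n) _
    have hcont : Continuous fun f : LpProj 𝕜 μ p d => Lp.const r μ (integralJ 𝕜 μ p d f) :=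
      (Lp.constL r μ 𝕜 : 𝕜 →L[𝕜] Lp 𝕜 r μ).continuous.comp (integralJ 𝕜 μ p d).continuous
    exact (LipschitzWith.uniformEquicontinuous _ 1 hlip).equicontinuous.isClosed_setOfPred_tendsto
      hcont
  | ih t =>
    induction t using PiTensorProduct.induction_on with
    | smul_tprod c f =>
      simp only [UniformSpace.Completion.coe_smul, map_smul, integralJ_tprod]
      have hc : Lp.const r μ (c • ∏ i, ∫ x, f i x ∂μ) = c • Lp.const r μ (∏ i, ∫ x, f i x ∂μ) :=
        (Lp.constₗ r μ 𝕜).map_smul c _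
      rw [hc]
      exact (tendsto_vStatL_tprod hT hr hp f).const_smul c
    | add a b ha hb =>
      simp only [UniformSpace.Completion.coe_add, map_add]
      exact ha.add hb

end Convergence
end VonMises

end

theorem theorem1 {𝕜 X : Type*} [RCLike 𝕜] [MeasurableSpace X]
    (μ : Measure X) [IsProbabilityMeasure μ] (T : X → X) (hT : Ergodic T μ)
    (d : ℕ) (hd : 2 ≤ d) (p r : ℝ≥0∞) [Fact (1 ≤ p)] [Fact (1 ≤ r)]
    (hdp : (d : ℝ≥0∞) ≤ p) (hp : p ≠ ∞) (hr : r = p / d)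
    (f : VonMises.LpProj 𝕜 μ p d) :
    (∀ᵐ x ∂μ, Tendsto (fun n : ℕ => VonMises.vStat hT.toMeasurePreserving hr f n x) atTop
      (𝓝 (∫ y, VonMises.embJ f y ∂(Measure.pi fun _ : Fin d => μ)))) ∧
    Tendsto (fun n : ℕ => VonMises.vStat hT.toMeasurePreserving hr f n) atTop
      (𝓝 (Lp.const r μ (∫ y, VonMises.embJ f y ∂(Measure.pi fun _ : Fin d => μ)))) := by
  simp only [VonMises.vStat_eq, ← VonMises.integralJ_apply]
  exact ⟨VonMises.tendsto_vStatL_ae hT (by omega) hdp hr f, VonMises.tendsto_vStatL hT hp hr f⟩
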